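/- Let $S=\{x_1,x_2,\ldots,x_n\}$ with $n\ge 1$ and $x_1<x_2<\cdots<x_n$ be a finite, factor-closed set of positive integers (every positive divisor of an element of $S$ lies in $S$). Let $f:\mathbb{Z}_+\to\mathbb{C}$ be semimultiplicative, that is, $f(\gcd(x,y))\,f(\operatorname{lcm}(x,y))=f(x)f(y)$ for all $x,y\in\mathbb{Z}_+$, with $f(x)\neq 0$ for all $x\in\mathbb{Z}_+$, and put $g=1/f$. Let $(S)_f=\big(f(\gcd(x_i,x_j))\big)_{i,j=1}^n$ and $[S]_f=\big(f(\operatorname{lcm}(x_i,x_j))\big)_{i,j=1}^n$ be the GCD and LCM matrices on $S$, and let $$l_i=\sum_{\substack{z\mid x_i\\ z\nmid x_j\ \text{for all } j<i}}(g*\mu)(z),\qquad i=1,\ldots,n,$$ where $*$ is Dirichlet convolution and $\mu$ is the Möbius function. Then $[S]_f$ is invertible if and only if $l_i\neq 0$ for all $i$. Suppose that this is the case, and let $$c_f=\min_{1\le i,j\le n}|f(\operatorname{lcm}(x_i,x_j))|,\qquad m_g=\min_{1\le i\le n}|l_i|.$$ Then every $[S]_f$-eigenvalue $\lambda$ of $(S)_f$,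 i.e. every $\lambda\in\mathbb{C}$ with $(S)_f v=\lambda[S]_f v$ for some $v\in\mathbb{C}^n\setminus\{0\}$, satisfies $$|\lambda|\leq 2c_f^{-1}m_g^{-1}\big(x_n^{3/2}\log x_n+(2\gamma-1)x_n^{3/2}+O(x_n)\big),$$ where $\gamma$ is the Euler–Mascheroni constant. If $x_n>70$, then moreover $$|\lambda|\leq c_f^{-1}m_g^{-1}x_n^{0.9594/\log\log x_n}\big(x_n\log x_n+(2\gamma-1)x_n+O(\sqrt{x_n})\big).$$ The constants implied by the $O$-terms are absolute: they do not depend on $n$, $S$, $f$ or $\lambda$. -/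

import Mathlib

namespace GcdLcm

/-- An arithmetical function `f` is semimultiplicative if `f(gcd(x,y)) f(lcm(x,y)) = f(x) f(y)`
for all positive integers `x`, `y`. -/
def Semimultiplicative (f : ArithmeticFunction ℂ) : Prop :=
  ∀ x y : ℕ, 0 < x → 0 < y → f (Nat.gcd x y) * f (Nat.lcm x y) = f x * f y

/-- The GCD matrix `(S)_f` on `S = {x_1, …, x_n}`. -/
def gcdMatrix {n : ℕ} (x : Fin n → ℕ) (f : ArithmeticFunction ℂ) : Matrix (Fin n) (Fin n) ℂ :=
  Matrix.of fun i j => f (Nat.gcd (x i) (x j))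

/-- The LCM matrix `[S]_f` on `S = {x_1, …, x_n}`. -/
def lcmMatrix {n : ℕ} (x : Fin n → ℕ) (f : ArithmeticFunction ℂ) : Matrix (Fin n) (Fin n) ℂ :=
  Matrix.of fun i j => f (Nat.lcm (x i) (x j))

/-- `lam` is a `B`-eigenvalue of `A`: `A v = lam B v` for some nonzero vector `v`. -/
def IsGeneralizedEigenvalue {n : ℕ} (A B : Matrix (Fin n) (Fin n) ℂ) (lam : ℂ) : Prop :=
  ∃ v : Fin n → ℂ, v ≠ 0 ∧ A.mulVec v = lam • B.mulVec v

/-- The pointwise reciprocal `g = 1 / f`. -/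
noncomputable def recip (f : ArithmeticFunction ℂ) : ArithmeticFunction ℂ :=
  ⟨fun x => 1 / f x, by simp⟩

/-- `l_i`, the sum of `(g * μ)(z)` (Dirichlet convolution, `g = 1 / f`) over all `z ∣ x_i` such
that `z ∤ x_j` for every `j < i`. -/
noncomputable def lSum {n : ℕ} (x : Fin n → ℕ) (f : ArithmeticFunction ℂ) (i : Fin n) : ℂ :=
  ∑ z ∈ (Nat.divisors (x i)).filter (fun z => ∀ j : Fin n, j < i → ¬ z ∣ x j),
    (recip f * (ArithmeticFunction.moebius : ArithmeticFunction ℂ)) z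

/-- `c_f = min_{i,j} |f(lcm(x_i, x_j))|`. -/
noncomputable def cMin {n : ℕ} [NeZero n] (x : Fin n → ℕ) (f : ArithmeticFunction ℂ) : ℝ :=
  (Finset.univ : Finset (Fin n × Fin n)).inf' Finset.univ_nonempty
    fun p => ‖f (Nat.lcm (x p.1) (x p.2))‖

/-- `m_g = min_i |l_i|`. -/
noncomputable def mMin {n : ℕ} [NeZero n] (x : Fin n → ℕ) (f : ArithmeticFunction ℂ) : ℝ :=
  (Finset.univ : Finset (Fin n)).inf' Finset.univ_nonempty fun i => ‖lSum x f i‖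

end GcdLcm

/-! Let N be the largest element of S, E the divisibility matrix of S, Λ = diag(l_i), D =
diag(f(x_i)). Factor-closedness gives l_i = (g * μ)(x_i) and makes the Möbius matrix F inverse to E.
Semimultiplicativity gives [S]_f = D E Λ Eᵀ D, whence the invertibility criterion, and (S)_f = D
[S]_g D. With u = Eᵀ D v the eigenvalue equation becomes F [S]_g Fᵀ u = λ Λ u
(`moebiusMatrix_eigen`). Row i of F has absolute sum 2^ω(x_i), so the row of the largest coordinate
of u gives |λ| ≤ c_f⁻¹ m_g⁻¹ 2^ω(x_i) ∑_j 2^ω(x_j) (`exists_norm_eigenvalue_le`). The sum is at most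
∑_{m ≤ N} d(m), estimated by the hyperbola method. The remaining factor is at most 2√N, or, for
large N, N^(0.9594 / log log N) because ω(m)! ≤ m; small N are absorbed in the error constant. -/

namespace GcdLcm

/-! ### Prime factors and divisor counts -/

open Finset in
theorem factorial_card_le_prod (s : Finset ℕ) (hs : ∀ a ∈ s, 0 < a) :
    s.card.factorial ≤ ∏ a ∈ s, a := by
  induction s using Finset.induction_on_max with
  | empty => simp
  | insert a s hlt ih =>
    have ha : a ∉ s := fun h => lt_irrefl _ (hlt a h)
    rw [card_insert_of_notMem ha, prod_insert ha, Nat.factorial_succ]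
    refine Nat.mul_le_mul ?_ (ih fun b hb => hs b (mem_insert_of_mem hb))
    -- The maximum of k + 1 distinct positive integers is at least k + 1.
    have hsub : s ⊆ Ioo 0 a := fun b hb =>
      mem_Ioo.2 ⟨hs b (mem_insert_of_mem hb), hlt b hb⟩
    have hc := card_le_card hsub
    have h0 := hs a (mem_insert_self a s)
    rw [Nat.card_Ioo] at hc
    omega

theorem factorial_card_primeFactors_le {m : ℕ} (hm : m ≠ 0) :
    m.primeFactors.card.factorial ≤ m :=
  (factorial_card_le_prod _ fun _ hp => (Nat.prime_of_mem_primeFactors hp).pos).trans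
    (Nat.le_of_dvd (Nat.pos_of_ne_zero hm) (Nat.prod_primeFactors_dvd m))

theorem card_squarefree_divisors {m : ℕ} (hm : m ≠ 0) :
    (m.divisors.filter Squarefree).card = 2 ^ m.primeFactors.card := by
  have h := Nat.sum_divisors_filter_squarefree hm (f := fun _ => (1 : ℕ))
  rw [← Finset.card_eq_sum_ones, ← Finset.card_eq_sum_ones, Finset.card_powerset] at h
  rw [h]
  congr 2
  ext p
  rw [Nat.factors_eq, Multiset.mem_toFinset, Multiset.mem_coe, Nat.mem_primeFactors_iff_mem_primeFactorsList]

theorem two_pow_card_primeFactors_le {m : ℕ} (hm : m ≠ 0) :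
    2 ^ m.primeFactors.card ≤ m.divisors.card := by
  rw [← card_squarefree_divisors hm]
  exact Finset.card_filter_le _ _

theorem sum_divisors_norm_moebius {m : ℕ} (hm : m ≠ 0) :
    ∑ d ∈ m.divisors, ‖((ArithmeticFunction.moebius d : ℤ) : ℂ)‖ = 2 ^ m.primeFactors.card := by
  have h : ∀ d : ℕ, ‖((ArithmeticFunction.moebius d : ℤ) : ℂ)‖ = if Squarefree d then 1 else 0 := by
    intro d
    rw [Complex.norm_intCast, ← Int.cast_abs, ArithmeticFunction.abs_moebius]
    split_ifs <;> simp
  simp_rw [h]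
  rw [Finset.sum_boole, card_squarefree_divisors hm]
  push_cast
  rfl

/-- Each divisor `d` of `m` or its codivisor `m / d` is at most `√m`. -/
theorem card_divisors_le_two_mul_sqrt (m : ℕ) : m.divisors.card ≤ 2 * Nat.sqrt m := by
  have hsub : m.divisors ⊆
      Finset.Icc 1 (Nat.sqrt m) ∪ (Finset.Icc 1 (Nat.sqrt m)).image (fun d => m / d) := by
    intro d hd
    have hdm := Nat.dvd_of_mem_divisors hd
    have hm : m ≠ 0 := (Nat.mem_divisors.1 hd).2
    have hd0 := Nat.pos_of_mem_divisors hd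
    obtain ⟨e, rfl⟩ := hdm
    have he0 : 0 < e := Nat.pos_of_ne_zero (right_ne_zero_of_mul hm)
    rcases le_total d e with h | h
    · exact Finset.mem_union_left _
        (Finset.mem_Icc.2 ⟨hd0, Nat.le_sqrt.2 (Nat.mul_le_mul_left d h)⟩)
    · exact Finset.mem_union_right _ (Finset.mem_image.2 ⟨e, Finset.mem_Icc.2
        ⟨he0, Nat.le_sqrt.2 (Nat.mul_le_mul_right e h)⟩, Nat.mul_div_cancel _ he0⟩)
  calc _ ≤ _ := Finset.card_le_card hsub
    _ ≤ _ := Finset.card_union_le _ _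
    _ ≤ Nat.sqrt m + Nat.sqrt m := by
        refine Nat.add_le_add (by simp) (Finset.card_image_le.trans (by simp))
    _ = _ := by ring

/-! ### The Dirichlet divisor sum -/

/-- The hyperbola method. -/
theorem sum_card_divisors_add_sqrt_sq_le (N : ℕ) :
    ∑ m ∈ Finset.Ioc 0 N, m.divisors.card + Nat.sqrt N ^ 2
      ≤ 2 * ∑ a ∈ Finset.Ioc 0 (Nat.sqrt N), N / a := by
  classical
  set s := Nat.sqrt N
  have hsN : s ≤ N := Nat.sqrt_le_self N
  let P : Finset (ℕ × ℕ) := (Finset.Ioc 0 N ×ˢ Finset.Ioc 0 N).filter (fun p => p.1 * p.2 ≤ N)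
  let A := P.filter (fun p => p.1 ≤ s)
  let B := P.filter (fun p => p.2 ≤ s)
  have hP : ∑ m ∈ Finset.Ioc 0 N, m.divisors.card = P.card := by
    have hmaps : ∀ p ∈ P, p.1 * p.2 ∈ Finset.Ioc 0 N := by
      intro p hp
      simp only [P, Finset.mem_filter, Finset.mem_product, Finset.mem_Ioc] at hp ⊢
      exact ⟨Nat.mul_pos hp.1.1.1 hp.1.2.1, hp.2⟩
    rw [Finset.card_eq_sum_card_fiberwise hmaps]
    refine Finset.sum_congr rfl fun m hm => ?_
    rw [Finset.mem_Ioc] at hm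
    rw [← Finset.card_map, Nat.map_div_right_divisors]
    congr 1
    ext ⟨a, b⟩
    simp only [P, Finset.mem_filter, Finset.mem_product, Finset.mem_Ioc,
      Nat.mem_divisorsAntidiagonal]
    constructor
    · rintro ⟨rfl, h⟩
      have ha := Nat.pos_of_ne_zero (left_ne_zero_of_mul h)
      have hb := Nat.pos_of_ne_zero (right_ne_zero_of_mul h)
      exact ⟨⟨⟨⟨ha, (Nat.le_mul_of_pos_right a hb).trans hm.2⟩, hb,
        (Nat.le_mul_of_pos_left b ha).trans hm.2⟩, hm.2⟩, rfl⟩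
    · rintro ⟨-, rfl⟩
      exact ⟨rfl, hm.1.ne'⟩
  have hA : A.card = ∑ a ∈ Finset.Ioc 0 s, N / a := by
    have hmaps : ∀ p ∈ A, p.1 ∈ Finset.Ioc 0 s := by
      intro p hp
      simp only [A, P, Finset.mem_filter, Finset.mem_product, Finset.mem_Ioc] at hp ⊢
      exact ⟨hp.1.1.1.1, hp.2⟩
    rw [Finset.card_eq_sum_card_fiberwise hmaps]
    refine Finset.sum_congr rfl fun a ha => ?_
    rw [Finset.mem_Ioc] at ha
    have : A.filter (fun p => p.1 = a) = (Finset.Ioc 0 (N / a)).image (fun b => (a, b)) := by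
      ext ⟨c, b⟩
      simp only [A, P, Finset.mem_filter, Finset.mem_product, Finset.mem_Ioc, Finset.mem_image,
        Prod.mk.injEq]
      constructor
      · rintro ⟨⟨⟨⟨-, hb⟩, h⟩, -⟩, rfl⟩
        exact ⟨b, ⟨hb.1, (Nat.le_div_iff_mul_le ha.1).2 (by linarith [mul_comm b c])⟩, rfl, rfl⟩
      · rintro ⟨b, ⟨hb, h⟩, rfl, rfl⟩
        have h' := (Nat.le_div_iff_mul_le ha.1).1 h
        exact ⟨⟨⟨⟨⟨ha.1, ha.2.trans hsN⟩, hb, h.trans (Nat.div_le_self _ _)⟩,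
          by linarith [mul_comm b a]⟩, ha.2⟩, rfl⟩
    rw [this, Finset.card_image_of_injective _ (Prod.mk_right_injective a), Nat.card_Ioc,
      Nat.sub_zero]
  have hBA : B.card = A.card := by
    refine Finset.card_bij' (fun p _ => p.swap) (fun p _ => p.swap) ?_ ?_ ?_ ?_ <;>
    · intro p hp
      simp only [A, B, P, Finset.mem_filter, Finset.mem_product, Finset.mem_Ioc, Prod.fst_swap,
        Prod.snd_swap, Prod.swap_swap] at hp ⊢
      try exact ⟨⟨⟨hp.1.1.2, hp.1.1.1⟩, by rw [mul_comm]; exact hp.1.2⟩, hp.2⟩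
  have hunion : P ⊆ A ∪ B := by
    intro p hp
    rw [Finset.mem_union]
    by_contra! h
    have h1 : s < p.1 := by by_contra! h'; exact h.1 (Finset.mem_filter.2 ⟨hp, h'⟩)
    have h2 : s < p.2 := by by_contra! h'; exact h.2 (Finset.mem_filter.2 ⟨hp, h'⟩)
    have h3 := (Finset.mem_filter.1 hp).2
    have h4 : N < (s + 1) * (s + 1) := Nat.lt_succ_sqrt N
    exact absurd (h4.trans_le (Nat.mul_le_mul h1 h2)) (not_lt.2 h3)
  have hinter : Finset.Ioc 0 s ×ˢ Finset.Ioc 0 s ⊆ A ∩ B := by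
    intro p hp
    simp only [A, B, P, Finset.mem_filter, Finset.mem_product, Finset.mem_Ioc,
      Finset.mem_inter] at hp ⊢
    have h3 : p.1 * p.2 ≤ N := (Nat.mul_le_mul hp.1.2 hp.2.2).trans (Nat.sqrt_le N)
    have h4 := hp.1.2.trans hsN
    have h5 := hp.2.2.trans hsN
    tauto
  have h1 := Finset.card_union_add_card_inter A B
  have h2 := Finset.card_le_card hunion
  have h3 := Finset.card_le_card hinter
  rw [Finset.card_product, Nat.card_Ioc, Nat.sub_zero] at h3
  rw [hP, ← hA, sq]
  omega

open Real in
theorem sum_card_divisors_le {N : ℕ} (hN : 0 < N) :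
    (∑ m ∈ Finset.Ioc 0 N, (m.divisors.card : ℝ))
      ≤ N * log N + (2 * eulerMascheroniConstant - 1) * N + 6 * √N := by
  have hyp := sum_card_divisors_add_sqrt_sq_le N
  set s := Nat.sqrt N with hs
  have hs0 : 0 < s := Nat.sqrt_pos.2 hN
  have hsR : (1 : ℝ) ≤ s := by exact_mod_cast hs0
  have hNR : (1 : ℝ) ≤ N := by exact_mod_cast hN
  have hyp' : (∑ m ∈ Finset.Ioc 0 N, (m.divisors.card : ℝ)) + (s : ℝ) ^ 2
      ≤ 2 * ∑ a ∈ Finset.Ioc 0 s, ((N / a : ℕ) : ℝ) := by exact_mod_cast hyp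
  have hdiv : ∑ a ∈ Finset.Ioc 0 s, ((N / a : ℕ) : ℝ) ≤ N * (harmonic s : ℝ) := by
    rw [harmonic_eq_sum_Icc, Rat.cast_sum, Finset.mul_sum]
    have : Finset.Icc 1 s = Finset.Ioc 0 s := by ext; simp [Nat.succ_le_iff]
    rw [this]
    refine Finset.sum_le_sum fun a _ => ?_
    push_cast
    rw [← div_eq_mul_inv]
    exact Nat.cast_div_le
  -- `eulerMascheroniSeq` subtracts log (s + 1), not log s; the shift costs 1 / s.
  have hharm : (harmonic s : ℝ) ≤ eulerMascheroniConstant + log s + 1 / s := by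
    have h := (eulerMascheroniSeq_lt_eulerMascheroniConstant s).le
    rw [eulerMascheroniSeq] at h
    have h2 : log ((s : ℝ) + 1) ≤ log s + 1 / s := by
      have : (s : ℝ) + 1 = s * (1 + 1 / s) := by field_simp
      rw [this, log_mul (by positivity) (by positivity)]
      have := log_le_sub_one_of_pos (show (0 : ℝ) < 1 + 1 / s by positivity)
      linarith
    linarith
  have hle : (s : ℝ) ≤ √N := Real.nat_sqrt_le_real_sqrt
  have hge : √N ≤ s + 1 := Real.real_sqrt_le_nat_sqrt_succ
  have hsq : √(N : ℝ) ^ 2 = N := sq_sqrt (by positivity)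
  have hlog : log s ≤ log N / 2 := by
    rw [← log_sqrt (by positivity)]
    exact log_le_log (by positivity) hle
  -- √N ≤ s + 1 ≤ 2 s. Doubled, this error gives 4√N; the loss 2√N in `hs2` makes it 6√N.
  have hfrac : (N : ℝ) * (1 / s) ≤ 2 * √N := by
    rw [mul_one_div, div_le_iff₀ (by positivity)]
    nlinarith [sqrt_nonneg (N : ℝ)]
  have hs2 : (N : ℝ) - 2 * √N ≤ s ^ 2 := by nlinarith
  have hmain : (N : ℝ) * (harmonic s : ℝ)
      ≤ N * (eulerMascheroniConstant + log N / 2) + 2 * √N := by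
    calc (N : ℝ) * (harmonic s : ℝ) ≤ N * (eulerMascheroniConstant + log s + 1 / s) := by gcongr
      _ ≤ N * (eulerMascheroniConstant + log N / 2 + 1 / s) := by gcongr
      _ = N * (eulerMascheroniConstant + log N / 2) + N * (1 / s) := by ring
      _ ≤ _ := by gcongr
  linarith

/-! ### Growth of 2^ω(m) -/

open Real Filter in
-- Stirling's k log k - k ≤ log x bounds k by a constant times log x / log log x. Any constant below
-- 0.9594 / log 2 ≈ 1.3841 suffices, hence 1.384.
theorem eventually_mul_log_two_le_of_factorial_le :
    ∀ᶠ x : ℝ in atTop, ∀ k : ℕ, (k.factorial : ℝ) ≤ x →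
      k * log 2 ≤ 0.9594 / log (log x) * log x := by
  have h1 := (isLittleO_log_rpow_atTop (show (0 : ℝ) < 1 / 5 by norm_num)).bound one_pos
  have hev : ∀ᶠ L : ℝ in atTop, 14 ≤ log L ∧ 1 < L ∧ log L ≤ L ^ (1 / 5 : ℝ) := by
    filter_upwards [h1, tendsto_log_atTop.eventually_ge_atTop 14, eventually_gt_atTop 1]
      with L h h14 hL
    refine ⟨h14, hL, (le_abs_self _).trans ?_⟩
    rwa [one_mul, norm_eq_abs, norm_eq_abs, abs_of_nonneg (a := L ^ _) (by positivity)] at h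
  filter_upwards [tendsto_log_atTop.eventually hev, eventually_gt_atTop 0] with x hx hx0 k hk
  obtain ⟨h14, hL1, hlog⟩ := hx
  set L := log x
  set M := log L
  have hM : 0 < M := by linarith
  have hL : 0 < L := by linarith
  have key : (k : ℝ) * M ≤ 1.384 * L := by
    -- Small k satisfy k M ≤ L outright. Otherwise log k ≥ 4M/5, so k M (4/5 - 1/M) ≤ L, and M ≥ 14
    -- gives k M ≤ (70/51) L < 1.384 L.
    rcases le_or_gt (k : ℝ) (L ^ (4 / 5 : ℝ)) with hkL | hkL
    · calc (k : ℝ) * M ≤ L ^ (4 / 5 : ℝ) * L ^ (1 / 5 : ℝ) := by gcongr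
        _ = L := by rw [← rpow_add hL]; norm_num
        _ ≤ _ := by linarith
    · have hk0 : (0 : ℝ) < k := lt_trans (by positivity) hkL
      have hlk : 4 / 5 * M ≤ log k := by
        rw [← log_rpow hL]
        exact log_le_log (by positivity) hkL.le
      have hfac : (k : ℝ) * log k - k ≤ L := by
        have h := pow_div_factorial_le_exp (k : ℝ) hk0.le k
        have hf : (0 : ℝ) < k.factorial := by positivity
        rw [div_le_iff₀ hf] at h
        have h' : (k : ℝ) ^ k ≤ exp k * x := h.trans (by gcongr)
        have h2 := log_le_log (by positivity) h'
        rw [log_pow, log_mul (exp_ne_zero _) hx0.ne', log_exp] at h2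
        linarith
      have : (k : ℝ) * (4 / 5 * M) ≤ k * log k := by gcongr
      nlinarith [mul_le_mul_of_nonneg_left h14 hk0.le]
  have hl2 : log 2 ≤ 0.6932 := by linarith [log_two_lt_d9]
  rw [div_mul_eq_mul_div, le_div_iff₀ hM]
  have h2 : 0 ≤ log 2 := log_nonneg one_le_two
  nlinarith [log_two_lt_d9, mul_le_mul_of_nonneg_left key h2]

open Real Filter in
theorem exists_two_pow_card_primeFactors_le_rpow :
    ∃ X : ℕ, ∀ N m : ℕ, X ≤ N → m ≠ 0 → m ≤ N →
      (2 : ℝ) ^ m.primeFactors.card ≤ (N : ℝ) ^ ((0.9594 : ℝ) / log (log N)) := by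
  have h := (tendsto_natCast_atTop_atTop (R := ℝ)).eventually
    eventually_mul_log_two_le_of_factorial_le
  obtain ⟨X, hX⟩ := eventually_atTop.1 h
  refine ⟨X, fun N m hXN hm hmN => ?_⟩
  have hN : (0 : ℝ) < N := by exact_mod_cast (Nat.pos_of_ne_zero hm).trans_le hmN
  have hk := hX N hXN m.primeFactors.card
    (by exact_mod_cast (factorial_card_primeFactors_le hm).trans hmN)
  rw [← rpow_natCast, rpow_def_of_pos two_pos, rpow_def_of_pos hN]
  refine exp_le_exp.2 ?_
  linarith [mul_comm (log 2) (m.primeFactors.card : ℝ), mul_comm (log N) (0.9594 / log (log N))]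


/-! ### Divisibility and Möbius matrices -/

open Matrix

/-- The incidence matrix of divisibility on `S`. -/
def divMatrix {n : ℕ} (x : Fin n → ℕ) : Matrix (Fin n) (Fin n) ℂ :=
  Matrix.of fun i j => if x j ∣ x i then 1 else 0

/-- The matrix of the Möbius function of divisibility on `S`. -/
def moebiusMatrix {n : ℕ} (x : Fin n → ℕ) : Matrix (Fin n) (Fin n) ℂ :=
  Matrix.of fun i j =>
    if x j ∣ x i then ((ArithmeticFunction.moebius (x i / x j) : ℤ) : ℂ) else 0

theorem sum_ite_dvd_eq_sum_divisors {M : Type*} [AddCommMonoid M] {n m : ℕ} {x : Fin n → ℕ}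
    (hinj : Function.Injective x) (hm : m ≠ 0) (hfc : ∀ d, d ∣ m → ∃ j, x j = d) (h : ℕ → M) :
    ∑ j, (if x j ∣ m then h (x j) else 0) = ∑ d ∈ m.divisors, h d := by
  rw [← Finset.sum_filter]
  refine Finset.sum_nbij x ?_ hinj.injOn ?_ fun _ _ => rfl
  · intro j hj
    exact Nat.mem_divisors.2 ⟨(Finset.mem_filter.1 hj).2, hm⟩
  · intro d hd
    have hdm := Nat.dvd_of_mem_divisors (Finset.mem_coe.1 hd)
    obtain ⟨j, rfl⟩ := hfc d hdm
    exact ⟨j, by simpa using hdm, rfl⟩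

/-- Möbius inversion of ∑_{d ∣ m} [d = a] = [a ∣ m]. -/
theorem sum_divisors_moebius_mul_ite {m a : ℕ} (hm : 0 < m) :
    ∑ d ∈ m.divisors, ((ArithmeticFunction.moebius (m / d) : ℤ) : ℂ) * (if a ∣ d then 1 else 0)
      = if m = a then 1 else 0 := by
  have h := (ArithmeticFunction.sum_eq_iff_sum_mul_moebius_eq
    (f := fun d => if d = a then (1 : ℂ) else 0) (g := fun d => if a ∣ d then (1 : ℂ) else 0)).1
    (fun d hd => by simp [Finset.sum_ite_eq', Nat.mem_divisors, hd.ne']) m hm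
  rwa [Nat.sum_divisorsAntidiagonal'
    (f := fun b c => ((ArithmeticFunction.moebius b : ℤ) : ℂ) * (if a ∣ c then 1 else 0))] at h

theorem moebiusMatrix_mul_divMatrix {n : ℕ} {x : Fin n → ℕ} (hpos : ∀ i, 0 < x i)
    (hinj : Function.Injective x) (hfc : ∀ i d, d ∣ x i → ∃ j, x j = d) :
    moebiusMatrix x * divMatrix x = 1 := by
  ext i j
  rw [Matrix.mul_apply, Matrix.one_apply]
  simp only [moebiusMatrix, divMatrix, Matrix.of_apply, ite_mul, zero_mul]
  rw [sum_ite_dvd_eq_sum_divisors hinj (hpos i).ne' (hfc i)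
    (fun d => ((ArithmeticFunction.moebius (x i / d) : ℤ) : ℂ) * (if x j ∣ d then 1 else 0)),
    sum_divisors_moebius_mul_ite (hpos i)]
  simp [hinj.eq_iff]

theorem divMatrix_mul_diagonal_mul_transpose {n : ℕ} {x : Fin n → ℕ} (hpos : ∀ i, 0 < x i)
    (hinj : Function.Injective x) (hfc : ∀ i d, d ∣ x i → ∃ j, x j = d)
    (g : ArithmeticFunction ℂ) :
    divMatrix x * diagonal (fun k => (g * (ArithmeticFunction.moebius : ArithmeticFunction ℂ)) (x k))
      * (divMatrix x)ᵀ = gcdMatrix x g := by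
  set h := g * (ArithmeticFunction.moebius : ArithmeticFunction ℂ) with hh
  ext i j
  have hg0 : Nat.gcd (x i) (x j) ≠ 0 := (Nat.gcd_pos_of_pos_left _ (hpos i)).ne'
  have hgi : Nat.gcd (x i) (x j) ∣ x i := Nat.gcd_dvd_left _ _
  have hsum : ∑ d ∈ (Nat.gcd (x i) (x j)).divisors, h d = g (Nat.gcd (x i) (x j)) := by
    rw [← ArithmeticFunction.coe_mul_zeta_apply, hh, mul_assoc,
      ArithmeticFunction.coe_moebius_mul_coe_zeta, mul_one]
  rw [Matrix.mul_apply]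
  simp only [Matrix.mul_diagonal, divMatrix, gcdMatrix, Matrix.of_apply, Matrix.transpose_apply]
  rw [← hsum, ← sum_ite_dvd_eq_sum_divisors hinj hg0 (fun d hd => hfc i d (hd.trans hgi)) h]
  refine Finset.sum_congr rfl fun k _ => ?_
  by_cases h1 : x k ∣ x i <;> by_cases h2 : x k ∣ x j <;> simp [h1, h2, Nat.dvd_gcd_iff]

/-- A proper divisor of x_i is itself an earlier element of S, so the filter leaves only z = x_i. -/
theorem lSum_eq {n : ℕ} {x : Fin n → ℕ} (f : ArithmeticFunction ℂ) (hpos : ∀ i, 0 < x i)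
    (hmono : StrictMono x) (hfc : ∀ i d, d ∣ x i → ∃ j, x j = d) (i : Fin n) :
    lSum x f i = (recip f * (ArithmeticFunction.moebius : ArithmeticFunction ℂ)) (x i) := by
  have : (Nat.divisors (x i)).filter (fun z => ∀ j : Fin n, j < i → ¬ z ∣ x j) = {x i} := by
    ext z
    simp only [Finset.mem_filter, Nat.mem_divisors, Finset.mem_singleton]
    constructor
    · rintro ⟨⟨hz, -⟩, hj⟩
      obtain ⟨k, rfl⟩ := hfc i z hz
      by_contra hne
      exact hj k (hmono.lt_iff_lt.1 (lt_of_le_of_ne (Nat.le_of_dvd (hpos i) hz) hne)) dvd_rfl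
    · rintro rfl
      exact ⟨⟨dvd_rfl, (hpos i).ne'⟩, fun j hj hd =>
        absurd (Nat.le_of_dvd (hpos j) hd) (not_le.2 (hmono hj))⟩
  rw [lSum, this, Finset.sum_singleton]

/-! ### Matrix factorizations and the reduced eigenvalue problem -/

theorem lcmMatrix_eq {n : ℕ} {x : Fin n → ℕ} {f : ArithmeticFunction ℂ} (hpos : ∀ i, 0 < x i)
    (hf : Semimultiplicative f) (hf0 : ∀ m : ℕ, 0 < m → f m ≠ 0) :
    lcmMatrix x f = diagonal (fun i => f (x i)) * gcdMatrix x (recip f)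
      * diagonal (fun i => f (x i)) := by
  ext i j
  have h0 := hf0 _ (Nat.gcd_pos_of_pos_left (x j) (hpos i))
  have h := hf (x i) (x j) (hpos i) (hpos j)
  simp only [Matrix.mul_diagonal, Matrix.diagonal_mul, lcmMatrix, gcdMatrix, Matrix.of_apply,
    recip, ArithmeticFunction.coe_mk]
  field_simp
  linear_combination h

theorem gcdMatrix_eq {n : ℕ} {x : Fin n → ℕ} {f : ArithmeticFunction ℂ} (hpos : ∀ i, 0 < x i)
    (hf : Semimultiplicative f) (hf0 : ∀ m : ℕ, 0 < m → f m ≠ 0) :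
    gcdMatrix x f = diagonal (fun i => f (x i)) * lcmMatrix x (recip f)
      * diagonal (fun i => f (x i)) := by
  ext i j
  have h0 := hf0 _ (Nat.lcm_pos (hpos i) (hpos j))
  have h := hf (x i) (x j) (hpos i) (hpos j)
  simp only [Matrix.mul_diagonal, Matrix.diagonal_mul, lcmMatrix, gcdMatrix, Matrix.of_apply,
    recip, ArithmeticFunction.coe_mk]
  field_simp
  linear_combination h

/-- The factorization `[S]_f = D E Λ Eᵀ D`. -/
theorem lcmMatrix_factorization {n : ℕ} {x : Fin n → ℕ} {f : ArithmeticFunction ℂ}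
    (hpos : ∀ i, 0 < x i) (hmono : StrictMono x) (hfc : ∀ i d, d ∣ x i → ∃ j, x j = d)
    (hf : Semimultiplicative f) (hf0 : ∀ m : ℕ, 0 < m → f m ≠ 0) :
    lcmMatrix x f = diagonal (fun i => f (x i)) *
      (divMatrix x * diagonal (lSum x f) * (divMatrix x)ᵀ) * diagonal (fun i => f (x i)) := by
  rw [lcmMatrix_eq hpos hf hf0,
    ← divMatrix_mul_diagonal_mul_transpose hpos hmono.injective hfc,
    funext (lSum_eq f hpos hmono hfc)]

theorem isUnit_lcmMatrix_iff {n : ℕ} {x : Fin n → ℕ} {f : ArithmeticFunction ℂ}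
    (hpos : ∀ i, 0 < x i) (hmono : StrictMono x) (hfc : ∀ i d, d ∣ x i → ∃ j, x j = d)
    (hf : Semimultiplicative f) (hf0 : ∀ m : ℕ, 0 < m → f m ≠ 0) :
    IsUnit (lcmMatrix x f) ↔ ∀ i, lSum x f i ≠ 0 := by
  have hE : (divMatrix x).det ≠ 0 := by
    intro h
    have := congrArg Matrix.det (moebiusMatrix_mul_divMatrix hpos hmono.injective hfc)
    simp [Matrix.det_mul, h] at this
  have hD : ∏ i, f (x i) ≠ 0 := Finset.prod_ne_zero_iff.2 fun i _ => hf0 _ (hpos i)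
  rw [Matrix.isUnit_iff_isUnit_det, isUnit_iff_ne_zero,
    lcmMatrix_factorization hpos hmono hfc hf hf0]
  simp [Matrix.det_mul, Matrix.det_transpose, Matrix.det_diagonal, hE, hD,
    Finset.prod_ne_zero_iff]

theorem sum_norm_moebiusMatrix {n : ℕ} {x : Fin n → ℕ} (hpos : ∀ i, 0 < x i)
    (hinj : Function.Injective x) (hfc : ∀ i d, d ∣ x i → ∃ j, x j = d) (i : Fin n) :
    ∑ k, ‖moebiusMatrix x i k‖ = 2 ^ (x i).primeFactors.card := by
  have h : ∀ k, ‖moebiusMatrix x i k‖ =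
      if x k ∣ x i then ‖((ArithmeticFunction.moebius (x i / x k) : ℤ) : ℂ)‖ else 0 := by
    intro k
    rw [moebiusMatrix, Matrix.of_apply]
    split_ifs <;> simp
  simp_rw [h]
  rw [sum_ite_dvd_eq_sum_divisors hinj (hpos i).ne' (hfc i)
    (fun d => ‖((ArithmeticFunction.moebius (x i / d) : ℤ) : ℂ)‖),
    Nat.sum_div_divisors (x i) (fun d => ‖((ArithmeticFunction.moebius d : ℤ) : ℂ)‖),
    sum_divisors_norm_moebius (hpos i).ne']

theorem moebiusMatrix_eigen {n : ℕ} {x : Fin n → ℕ} {f : ArithmeticFunction ℂ}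
    (hpos : ∀ i, 0 < x i) (hmono : StrictMono x) (hfc : ∀ i d, d ∣ x i → ∃ j, x j = d)
    (hf : Semimultiplicative f) (hf0 : ∀ m : ℕ, 0 < m → f m ≠ 0) {lam : ℂ}
    (h : IsGeneralizedEigenvalue (gcdMatrix x f) (lcmMatrix x f) lam) :
    IsGeneralizedEigenvalue (moebiusMatrix x * lcmMatrix x (recip f) * (moebiusMatrix x)ᵀ)
      (diagonal (lSum x f)) lam := by
  obtain ⟨v, hv, hev⟩ := h
  rw [lcmMatrix_factorization hpos hmono hfc hf hf0, gcdMatrix_eq hpos hf hf0] at hev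
  have hFE := moebiusMatrix_mul_divMatrix hpos hmono.injective hfc
  have hFEt : (moebiusMatrix x)ᵀ * (divMatrix x)ᵀ = 1 := by
    rw [← Matrix.transpose_mul, mul_eq_one_comm.1 hFE, Matrix.transpose_one]
  set E := divMatrix x
  set F := moebiusMatrix x
  set G := lcmMatrix x (recip f)
  set D : Matrix (Fin n) (Fin n) ℂ := diagonal (fun i => f (x i))
  set D' : Matrix (Fin n) (Fin n) ℂ := diagonal (fun i => (f (x i))⁻¹)
  have hDD : D' * D = 1 := by
    rw [Matrix.diagonal_mul_diagonal, ← Matrix.diagonal_one]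
    congr 1
    funext i
    exact inv_mul_cancel₀ (hf0 _ (hpos i))
  -- The substitution u = Eᵀ D v is invertible, so u ≠ 0.
  have hback : D' *ᵥ (Fᵀ *ᵥ ((Eᵀ * D) *ᵥ v)) = v := by
    rw [Matrix.mulVec_mulVec, Matrix.mulVec_mulVec, ← Matrix.mul_assoc, Matrix.mul_assoc D' Fᵀ Eᵀ,
      hFEt, Matrix.mul_one, hDD, Matrix.one_mulVec]
  refine ⟨(Eᵀ * D) *ᵥ v, fun h0 => hv ?_, ?_⟩
  · rw [← hback, h0, Matrix.mulVec_zero, Matrix.mulVec_zero]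
  · have := congrArg (fun w => (F * D') *ᵥ w) hev
    simp only [Matrix.mulVec_smul, Matrix.mulVec_mulVec] at this
    rw [Matrix.mulVec_mulVec, Matrix.mulVec_mulVec]
    have h1 : F * G * Fᵀ * (Eᵀ * D) = F * D' * (D * G * D) := by
      calc _ = F * G * (Fᵀ * Eᵀ) * D := by simp only [Matrix.mul_assoc]
        _ = F * (D' * D) * G * D := by rw [hFEt, hDD, Matrix.mul_one, Matrix.mul_one]
        _ = _ := by simp only [Matrix.mul_assoc]
    have h2 : diagonal (lSum x f) * (Eᵀ * D)
        = F * D' * (D * (E * diagonal (lSum x f) * Eᵀ) * D) := by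
      calc _ = (F * E) * diagonal (lSum x f) * Eᵀ * D := by
              rw [hFE, Matrix.one_mul, Matrix.mul_assoc]
        _ = F * (D' * D) * E * diagonal (lSum x f) * Eᵀ * D := by rw [hDD, Matrix.mul_one]
        _ = _ := by simp only [Matrix.mul_assoc]
    rw [h1, h2, this]

/-! ### The eigenvalue estimate -/

theorem cMin_pos {n : ℕ} [NeZero n] {x : Fin n → ℕ} {f : ArithmeticFunction ℂ}
    (hpos : ∀ i, 0 < x i) (hf0 : ∀ m : ℕ, 0 < m → f m ≠ 0) : 0 < cMin x f := by
  rw [cMin, Finset.lt_inf'_iff]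
  exact fun p _ => norm_pos_iff.2 (hf0 _ (Nat.lcm_pos (hpos _) (hpos _)))

theorem norm_lcmMatrix_recip_le {n : ℕ} [NeZero n] {x : Fin n → ℕ} {f : ArithmeticFunction ℂ}
    (hpos : ∀ i, 0 < x i) (hf0 : ∀ m : ℕ, 0 < m → f m ≠ 0) (i j : Fin n) :
    ‖lcmMatrix x (recip f) i j‖ ≤ (cMin x f)⁻¹ := by
  simp only [lcmMatrix, Matrix.of_apply, recip, ArithmeticFunction.coe_mk]
  rw [one_div, norm_inv]
  exact inv_anti₀ (cMin_pos hpos hf0) (Finset.inf'_le _ (Finset.mem_univ (i, j)))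

theorem norm_mul_mul_transpose_apply_le {n : ℕ} {F G : Matrix (Fin n) (Fin n) ℂ} {c : ℝ}
    (hG : ∀ i j, ‖G i j‖ ≤ c) (i j : Fin n) :
    ‖(F * G * Fᵀ) i j‖ ≤ c * (∑ k, ‖F i k‖) * ∑ k, ‖F j k‖ := by
  rw [Matrix.mul_apply, Finset.mul_sum]
  refine norm_sum_le_of_le _ fun m _ => ?_
  rw [norm_mul, Matrix.transpose_apply]
  refine mul_le_mul_of_nonneg_right ?_ (norm_nonneg _)
  rw [Matrix.mul_apply, Finset.mul_sum]
  refine norm_sum_le_of_le _ fun k _ => ?_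
  rw [norm_mul, mul_comm]
  exact mul_le_mul_of_nonneg_right (hG k m) (norm_nonneg _)

/-- As in Gershgorin's argument, compare the coordinates at an index where |u_i| is maximal. -/
theorem exists_norm_mul_norm_le_of_isGeneralizedEigenvalue_diagonal {n : ℕ}
    {A : Matrix (Fin n) (Fin n) ℂ} {l : Fin n → ℂ} {lam : ℂ}
    (h : IsGeneralizedEigenvalue A (diagonal l) lam) :
    ∃ i, ‖lam‖ * ‖l i‖ ≤ ∑ j, ‖A i j‖ := by
  obtain ⟨u, hu, hev⟩ := h
  obtain ⟨i₀, hi₀⟩ := Function.ne_iff.1 hu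
  obtain ⟨i, -, hi⟩ := Finset.exists_max_image Finset.univ (fun i => ‖u i‖) ⟨i₀, Finset.mem_univ _⟩
  have hpos : 0 < ‖u i‖ := (norm_pos_iff.2 hi₀).trans_le (hi i₀ (Finset.mem_univ _))
  refine ⟨i, le_of_mul_le_mul_right ?_ hpos⟩
  have h := congrFun hev i
  rw [Pi.smul_apply, Matrix.mulVec_diagonal, smul_eq_mul] at h
  rw [mul_assoc, ← norm_mul, ← norm_mul, ← h, Finset.sum_mul]
  change ‖∑ j, A i j * u j‖ ≤ _
  refine norm_sum_le_of_le _ fun j _ => ?_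
  rw [norm_mul]
  exact mul_le_mul_of_nonneg_left (hi j (Finset.mem_univ _)) (norm_nonneg _)

theorem exists_norm_eigenvalue_le {n : ℕ} [NeZero n] {x : Fin n → ℕ} {f : ArithmeticFunction ℂ}
    (hpos : ∀ i, 0 < x i) (hmono : StrictMono x) (hfc : ∀ i d, d ∣ x i → ∃ j, x j = d)
    (hf : Semimultiplicative f) (hf0 : ∀ m : ℕ, 0 < m → f m ≠ 0)
    (hl : ∀ i, lSum x f i ≠ 0) {lam : ℂ}
    (h : IsGeneralizedEigenvalue (gcdMatrix x f) (lcmMatrix x f) lam) :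
    ∃ i, ‖lam‖ ≤ (cMin x f)⁻¹ * (mMin x f)⁻¹ *
      (2 ^ (x i).primeFactors.card * ∑ j, 2 ^ (x j).primeFactors.card) := by
  obtain ⟨i, hi⟩ := exists_norm_mul_norm_le_of_isGeneralizedEigenvalue_diagonal
    (moebiusMatrix_eigen hpos hmono hfc hf hf0 h)
  refine ⟨i, ?_⟩
  have hm : 0 < mMin x f := by
    rw [mMin, Finset.lt_inf'_iff]
    exact fun i _ => norm_pos_iff.2 (hl i)
  have hmi : mMin x f ≤ ‖lSum x f i‖ := Finset.inf'_le _ (Finset.mem_univ i)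
  have hsum : ∑ j, ‖(moebiusMatrix x * lcmMatrix x (recip f) * (moebiusMatrix x)ᵀ) i j‖
      ≤ (cMin x f)⁻¹ * (2 ^ (x i).primeFactors.card * ∑ j, 2 ^ (x j).primeFactors.card) := by
    rw [← mul_assoc, Finset.mul_sum]
    refine Finset.sum_le_sum fun j _ => ?_
    rw [← sum_norm_moebiusMatrix hpos hmono.injective hfc i,
      ← sum_norm_moebiusMatrix hpos hmono.injective hfc j]
    exact norm_mul_mul_transpose_apply_le (norm_lcmMatrix_recip_le hpos hf0) i j
  have hfin := (mul_le_mul_of_nonneg_left hmi (norm_nonneg lam)).trans (hi.trans hsum)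
  rw [← le_div_iff₀ hm] at hfin
  refine hfin.trans_eq ?_
  rw [div_eq_mul_inv]
  ring

theorem sum_two_pow_card_primeFactors_le {n N : ℕ} {x : Fin n → ℕ} (hpos : ∀ i, 0 < x i)
    (hinj : Function.Injective x) (hN : ∀ i, x i ≤ N) :
    ∑ j, (2 : ℝ) ^ (x j).primeFactors.card ≤ ∑ m ∈ Finset.Ioc 0 N, (m.divisors.card : ℝ) := by
  calc ∑ j, (2 : ℝ) ^ (x j).primeFactors.card ≤ ∑ j, ((x j).divisors.card : ℝ) :=
        Finset.sum_le_sum fun j _ => by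
          exact_mod_cast two_pow_card_primeFactors_le (hpos j).ne'
    _ = ∑ m ∈ Finset.univ.image x, (m.divisors.card : ℝ) := by
        rw [Finset.sum_image fun _ _ _ _ h => hinj h]
    _ ≤ _ := by
        refine Finset.sum_le_sum_of_subset_of_nonneg ?_ fun _ _ _ => Nat.cast_nonneg _
        intro m hm
        obtain ⟨i, -, rfl⟩ := Finset.mem_image.1 hm
        exact Finset.mem_Ioc.2 ⟨hpos i, hN i⟩

end GcdLcm

/-- Here `S = {x 0 < x 1 < ⋯ < x n}`, so `x (Fin.last n)` is the largest element of `S`.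
The constants `C₁` and `C₂` of the two error terms are absolute. -/
theorem mainTheorem3 :
    ∃ C₁ C₂ : ℝ, ∀ (n : ℕ) (x : Fin (n + 1) → ℕ) (f : ArithmeticFunction ℂ),
      (∀ i, 0 < x i) → StrictMono x →
      (∀ (i : Fin (n + 1)) (d : ℕ), d ∣ x i → ∃ j, x j = d) →
      GcdLcm.Semimultiplicative f → (∀ m : ℕ, 0 < m → f m ≠ 0) →
      (IsUnit (GcdLcm.lcmMatrix x f) ↔ ∀ i, GcdLcm.lSum x f i ≠ 0) ∧
      ((∀ i, GcdLcm.lSum x f i ≠ 0) →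
        ∀ lam : ℂ,
          GcdLcm.IsGeneralizedEigenvalue (GcdLcm.gcdMatrix x f) (GcdLcm.lcmMatrix x f) lam →
          (‖lam‖ ≤ 2 * (GcdLcm.cMin x f)⁻¹ * (GcdLcm.mMin x f)⁻¹ *
            ((x (Fin.last n) : ℝ) ^ (3 / 2 : ℝ) * Real.log (x (Fin.last n) : ℝ)
              + (2 * Real.eulerMascheroniConstant - 1) * (x (Fin.last n) : ℝ) ^ (3 / 2 : ℝ)
              + C₁ * (x (Fin.last n) : ℝ))) ∧
          (70 < x (Fin.last n) →
            ‖lam‖ ≤ (GcdLcm.cMin x f)⁻¹ * (GcdLcm.mMin x f)⁻¹ *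
              (x (Fin.last n) : ℝ) ^
                ((0.9594 : ℝ) / Real.log (Real.log (x (Fin.last n) : ℝ))) *
              ((x (Fin.last n) : ℝ) * Real.log (x (Fin.last n) : ℝ)
                + (2 * Real.eulerMascheroniConstant - 1) * (x (Fin.last n) : ℝ)
                + C₂ * Real.sqrt (x (Fin.last n) : ℝ)))) := by

  obtain ⟨X, hX⟩ := GcdLcm.exists_two_pow_card_primeFactors_le_rpow
  -- 6 comes from the divisor sum; the extra term of C₂ dominates `w * W` for all N < X.
  refine ⟨6, 6 + 2 * X * (X ^ 2 + 6 * X), fun n x f hpos hmono hfc hf hf0 => ?_⟩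
  refine ⟨GcdLcm.isUnit_lcmMatrix_iff hpos hmono hfc hf hf0, fun hl lam hlam => ?_⟩
  obtain ⟨i, hi⟩ := GcdLcm.exists_norm_eigenvalue_le hpos hmono hfc hf hf0 hl hlam
  set N := x (Fin.last n) with hN
  have hle : ∀ j, x j ≤ N := fun j => hmono.monotone (Fin.le_last j)
  have hN0 : 0 < N := hpos _
  have hNR : (1 : ℝ) ≤ N := by exact_mod_cast hN0
  have hsum := (GcdLcm.sum_two_pow_card_primeFactors_le hpos hmono.injective hle).trans
    (GcdLcm.sum_card_divisors_le hN0)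
  set W : ℝ := ∑ j, (2 : ℝ) ^ (x j).primeFactors.card
  set w : ℝ := (2 : ℝ) ^ (x i).primeFactors.card with hw
  have hW : 0 ≤ W := Finset.sum_nonneg fun _ _ => by positivity
  have hw2 : w ≤ 2 * √N := by
    have h1 : w ≤ ((x i).divisors.card : ℝ) := by
      rw [hw]; exact_mod_cast GcdLcm.two_pow_card_primeFactors_le (hpos i).ne'
    have h2 : ((x i).divisors.card : ℝ) ≤ 2 * (Nat.sqrt (x i) : ℝ) := by
      exact_mod_cast GcdLcm.card_divisors_le_two_mul_sqrt (x i)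
    have h3 : (Nat.sqrt (x i) : ℝ) ≤ √N :=
      Real.nat_sqrt_le_real_sqrt.trans (Real.sqrt_le_sqrt (by exact_mod_cast hle i))
    linarith
  have hcm : 0 ≤ (GcdLcm.cMin x f)⁻¹ * (GcdLcm.mMin x f)⁻¹ := by
    refine mul_nonneg (inv_nonneg.2 (GcdLcm.cMin_pos hpos hf0).le) (inv_nonneg.2 ?_)
    exact Finset.le_inf' _ _ fun _ _ => norm_nonneg _
  have hsq : √(N : ℝ) * √N = N := Real.mul_self_sqrt (by positivity)
  have hcrude : w * W ≤ 2 * √N *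
      (N * Real.log N + (2 * Real.eulerMascheroniConstant - 1) * N + 6 * √N) := by
    gcongr
  refine ⟨?_, fun h70 => ?_⟩
  · have hrpow : (N : ℝ) ^ (3 / 2 : ℝ) = N * √N := by
      rw [Real.sqrt_eq_rpow, ← Real.rpow_one_add' (by positivity) (by norm_num)]
      norm_num
    refine (hi.trans (mul_le_mul_of_nonneg_left hcrude hcm)).trans_eq ?_
    rw [hrpow]
    linear_combination 12 * (GcdLcm.cMin x f)⁻¹ * (GcdLcm.mMin x f)⁻¹ * hsq
  · refine hi.trans ?_
    rw [mul_assoc (_ * _)]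
    refine mul_le_mul_of_nonneg_left ?_ hcm
    -- N > 70 > e makes log log N nonnegative, hence the power of N at least 1.
    have hlogN : 1 ≤ Real.log N := by
      rw [Real.le_log_iff_exp_le (by positivity)]
      have : (70 : ℝ) < N := by exact_mod_cast h70
      linarith [Real.exp_one_lt_d9]
    have hγ := Real.one_half_lt_eulerMascheroniConstant
    have hγ' := Real.eulerMascheroniConstant_lt_two_thirds
    have hmain : 0 ≤ (N : ℝ) * Real.log N + (2 * Real.eulerMascheroniConstant - 1) * N := by
      have : 0 ≤ 2 * Real.eulerMascheroniConstant - 1 := by linarith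
      positivity
    have hC : (0 : ℝ) ≤ 2 * X * (X ^ 2 + 6 * X) := by positivity
    have hsN : 0 ≤ √(N : ℝ) := Real.sqrt_nonneg _
    rcases le_or_gt X N with hXN | hXN
    · refine mul_le_mul (hX N (x i) hXN (hpos i).ne' (hle i)) (hsum.trans ?_) hW (by positivity)
      nlinarith
    · have hNX : (N : ℝ) ≤ X := by exact_mod_cast hXN.le
      have hone : 1 ≤ (N : ℝ) ^ ((0.9594 : ℝ) / Real.log (Real.log N)) :=
        Real.one_le_rpow hNR (div_nonneg (by norm_num) (Real.log_nonneg hlogN))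
      have hs1 : 1 ≤ √(N : ℝ) := Real.one_le_sqrt.2 hNR
      have hsle : √(N : ℝ) ≤ N := by nlinarith
      have hlogle : Real.log N ≤ N - 1 := Real.log_le_sub_one_of_pos (by positivity)
      have hbd : N * Real.log N + (2 * Real.eulerMascheroniConstant - 1) * N + 6 * √N
          ≤ (X : ℝ) ^ 2 + 6 * X := by
        nlinarith
      calc w * W ≤ 2 * √N * ((X : ℝ) ^ 2 + 6 * X) := hcrude.trans (by gcongr)
        _ ≤ 2 * X * ((X : ℝ) ^ 2 + 6 * X) := by gcongr; exact hsle.trans hNX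
        _ ≤ (6 + 2 * X * (X ^ 2 + 6 * X)) * √N := by nlinarith
        _ ≤ N * Real.log N + (2 * Real.eulerMascheroniConstant - 1) * N
            + (6 + 2 * X * (X ^ 2 + 6 * X)) * √N := by linarith
        _ ≤ _ := le_mul_of_one_le_left (by positivity) hone
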